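/- Let $G$ be an arbitrary group and let $x,h\in G$ with $h$ of finite order. For $y,k\in G$ with $k$ of finite order $d$, consider the bicyclic units of the integral group ring $\mathbb{Z}G$ $$\beta_{y,k}=1+(1-k)\,y\,(1+k+\cdots+k^{d-1}),\qquad \gamma_{y,k}=1+(1+k+\cdots+k^{d-1})\,y\,(1-k).$$ A pair $(u,v)$ of units of $\mathbb{Z}G$ is called a free pair if $u$ and $v$ freely generate a (non-abelian) free group of rank two. Then the following conditions are equivalent: 1. $x^{-1}hx\notin\langle h\rangle$; 2. $xhx^{-1}\notin\langle h\rangle$; 3. $\beta_{x,h}\neq 1$; 4. $\gamma_{x,h}\neq 1$; 5. $(\beta_{x,h},\beta_{x^{-1},xhx^{-1}})$ is a free pair; 6. $(\beta_{x,h},\gamma_{x^{-1},h})$ is a free pair; 7. $(\gamma_{x,h},\beta_{x^{-1},h})$ is a free pair; 8. $(\gamma_{x,h},\gamma_{x^{-1},x^{-1}hx})$ is a free pair. -/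

import Mathlib

/-- The natural image of a group element `g` in the integral group ring `ℤG`. -/
noncomputable def grpElt {G : Type*} [Group G] (g : G) : MonoidAlgebra ℤ G :=
  MonoidAlgebra.of ℤ G g

/-- `1 + h + h² + ⋯ + h^(d-1)` in `ℤG`, where `d` is the order of `h`.
(For `h` of infinite order this is the empty sum; it is only used for `h` of finite order.) -/
noncomputable def cycSum {G : Type*} [Group G] (h : G) : MonoidAlgebra ℤ G :=
  ∑ i ∈ Finset.range (orderOf h), grpElt h ^ i

theorem grpElt_pow_orderOf {G : Type*} [Group G] (h : G) : grpElt h ^ orderOf h = 1 := by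
  unfold grpElt
  rw [← map_pow, pow_orderOf_eq_one, map_one]

theorem cycSum_mul_one_sub {G : Type*} [Group G] (h : G) :
    cycSum h * (1 - grpElt h) = 0 := by
  unfold cycSum
  rw [geom_sum_mul_neg, grpElt_pow_orderOf, sub_self]

/-- If `a² = 0` in a ring, then `1 + a` is a unit, with inverse `1 - a`. -/
def oneAddUnit {R : Type*} [Ring R] (a : R) (ha : a * a = 0) : Rˣ where
  val := 1 + a
  inv := 1 - a
  val_inv := by
    have : (1 + a) * (1 - a) = 1 - a * a := by noncomm_ring
    rw [this, ha, sub_zero]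
  inv_val := by
    have : (1 - a) * (1 + a) = 1 - a * a := by noncomm_ring
    rw [this, ha, sub_zero]

theorem betaPart_sq {G : Type*} [Group G] (x h : G) :
    ((1 - grpElt h) * grpElt x * cycSum h) * ((1 - grpElt h) * grpElt x * cycSum h) = 0 := by
  have e : ((1 - grpElt h) * grpElt x * cycSum h) * ((1 - grpElt h) * grpElt x * cycSum h)
      = (1 - grpElt h) * grpElt x * (cycSum h * (1 - grpElt h)) * grpElt x * cycSum h := by
    simp only [mul_assoc]
  rw [e, cycSum_mul_one_sub]
  simp

theorem gammaPart_sq {G : Type*} [Group G] (x h : G) :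
    (cycSum h * grpElt x * (1 - grpElt h)) * (cycSum h * grpElt x * (1 - grpElt h)) = 0 := by
  have c : (1 - grpElt h) * cycSum h = 0 := by
    unfold cycSum
    rw [mul_neg_geom_sum, grpElt_pow_orderOf, sub_self]
  have e : (cycSum h * grpElt x * (1 - grpElt h)) * (cycSum h * grpElt x * (1 - grpElt h))
      = cycSum h * grpElt x * ((1 - grpElt h) * cycSum h) * grpElt x * (1 - grpElt h) := by
    simp only [mul_assoc]
  rw [e, c]
  simp

/-- The bicyclic unit `β_{x,h} = 1 + (1 - h) x (1 + h + ⋯ + h^(d-1))` of `ℤG`. -/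
noncomputable def bicyclicBeta {G : Type*} [Group G] (x h : G) : (MonoidAlgebra ℤ G)ˣ :=
  oneAddUnit ((1 - grpElt h) * grpElt x * cycSum h) (betaPart_sq x h)

/-- The bicyclic unit `γ_{x,h} = 1 + (1 + h + ⋯ + h^(d-1)) x (1 - h)` of `ℤG`. -/
noncomputable def bicyclicGamma {G : Type*} [Group G] (x h : G) : (MonoidAlgebra ℤ G)ˣ :=
  oneAddUnit (cycSum h * grpElt x * (1 - grpElt h)) (gammaPart_sq x h)

/-- `(u, v)` is a free pair: `u` and `v` freely generate a free group of rank two, that is,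
no non-trivial reduced word in two letters becomes trivial at `(u, v)`. -/
def IsFreePair {M : Type*} [Group M] (u v : M) : Prop :=
  Function.Injective (FreeGroup.lift ![u, v] : FreeGroup (Fin 2) →* M)

/-! If a conjugate of `h` lies in `⟨h⟩`, the sum of powers of `h` absorbs it and both bicyclic units
collapse to 1. The substance is the converse: all four pairs are free.

Each pair has the form `1 + a`, `1 + b` with `a² = b² = 0`. Suppose it is not free. Multiplication
by these units is modelled on unipotent 2 × 2 matrices whose parameter is `a * b`. By Sanov's
theorem a nontrivial word cannot vanish at a complex parameter of modulus at least 4, so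
`exists_aeval_mul_eq_zero_of_lift_eq_one` confines the spectrum of `a * b` on `ℓ²(G)` to the open
disc of radius 4.

Let `d` be the order of `h`, and `e` the projection `cycSum h / d`, of trace `1 / d`. In the corner
cut out by `e`, an operator of spectral radius less than `ρ` is similar to one of norm at most `ρ`,
so its trace is at most `ρ / d` in modulus (`norm_inner_apply_le_of_spectralRadius_lt`). Hence the
trace of `a * b` is less than `4 / d`. Counting solutions of equations in `G` shows that it is at
least `d` (`orderOf_le_coeff_one_of_notMem`, `orderOf_le_coeff_one_sq_of_notMem`), which is
impossible for `d ≥ 2`. -/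

/-! ### Operators similar to contractions, inside a closed star subalgebra -/

/-- An element with a contractive power is similar, inside any closed star subalgebra containing
it, to a contraction. -/
theorem exists_similar_contraction_of_norm_pow_le {A : Type*} [CStarAlgebra A] [PartialOrder A]
    [StarOrderedRing A] (S : StarSubalgebra ℂ A) (hS : IsClosed (S : Set A)) {y : A} (hy : y ∈ S)
    {N : ℕ} (hN : N ≠ 0) (hyN : ‖y ^ N‖ ≤ 1) :
    ∃ p ∈ S, ∃ q ∈ S, q * p = 1 ∧ ‖p * y * q‖ ≤ 1 := by
  -- The form defined by `s` is an inner product adapted to `y`, averaged over its first `N` powers;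
  -- `y` contracts it, and `s ^ (1/2)` is the similarity.
  set s : A := ∑ n ∈ Finset.range N, star (y ^ n) * y ^ n with hs
  have hsS : s ∈ S := sum_mem fun n _ => mul_mem (star_mem (pow_mem hy n)) (pow_mem hy n)
  have h1s : 1 ≤ s := by
    have := Finset.single_le_sum (f := fun n => star (y ^ n) * y ^ n)
      (fun n _ => star_mul_self_nonneg _) (Finset.mem_range.2 (Nat.pos_of_ne_zero hN))
    simpa [hs] using this
  have hs0 : 0 ≤ s := zero_le_one.trans h1s
  have hsu : IsUnit s := CStarAlgebra.isUnit_of_le 1 h1s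
  have hsp : IsStrictlyPositive s := hsu.isStrictlyPositive hs0
  have hmem : ∀ t : ℝ, s ^ t ∈ S := fun t => by
    have : IsClosed (S : Set A) := hS
    rw [CFC.rpow_eq_cfc_real]
    exact cfc_mem (𝕜 := ℝ) (𝕜' := ℂ) _ hsS
  have hsa : ∀ t : ℝ, star (s ^ t) = s ^ t := fun t =>
    (IsSelfAdjoint.of_nonneg CFC.rpow_nonneg).star_eq
  obtain ⟨p, hp, q, hq, hps, hqs, hpp, hqp, hpq⟩ : ∃ p ∈ S, ∃ q ∈ S, star p = p ∧ star q = q ∧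
      p * p = s ∧ q * p = 1 ∧ p * q = 1 :=
    ⟨s ^ (1 / 2 : ℝ), hmem _, s ^ (-(1 / 2) : ℝ), hmem _, hsa _, hsa _,
      by rw [← CFC.rpow_add hsu]; norm_num [CFC.rpow_one s hs0],
      CFC.rpow_neg_mul_rpow _ hsp, CFC.rpow_mul_rpow_neg _ hsp⟩
  refine ⟨p, hp, q, hq, hqp, ?_⟩
  have hysy : star y * s * y ≤ s := by
    -- Conjugation shifts the sum by one index, trading the term 1 at `n = 0` for the term at `n =
    -- N`.
    have h1 : star y * s * y + 1 = s + star (y ^ N) * y ^ N := by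
      rw [hs, ← Finset.sum_range_succ (fun n => star (y ^ n) * y ^ n), Finset.sum_range_succ',
        Finset.mul_sum, Finset.sum_mul]
      simp [pow_succ, mul_assoc]
    have h2 : star (y ^ N) * y ^ N ≤ 1 := by
      rw [← CStarAlgebra.norm_le_one_iff_of_nonneg _ (star_mul_self_nonneg _),
        CStarRing.norm_star_mul_self]
      exact mul_le_one₀ hyN (norm_nonneg _) hyN
    have h3 : star y * s * y + 1 ≤ s + 1 := h1 ▸ add_le_add_right h2 s
    exact le_of_add_le_add_right h3
  have hz : star (p * y * q) * (p * y * q) ≤ 1 := by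
    have h1 : star (p * y * q) * (p * y * q) = star q * (star y * s * y) * q := by
      rw [star_mul, star_mul, hps, ← hpp]; simp only [mul_assoc]
    have h2 : star q * s * q = 1 := by
      rw [hqs, ← hpp]
      calc q * (p * p) * q = (q * p) * (p * q) := by simp only [mul_assoc]
        _ = 1 := by rw [hqp, hpq, one_mul]
    rw [h1, ← h2]
    exact star_left_conjugate_le_conjugate hysy q
  rw [← CStarAlgebra.norm_le_one_iff_of_nonneg _ (star_mul_self_nonneg _),
    CStarRing.norm_star_mul_self] at hz
  nlinarith [norm_nonneg (p * y * q)]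

/-- An element of spectral radius less than `ρ` is similar, inside any closed star subalgebra
containing it, to an element of norm at most `ρ`. -/
theorem exists_similar_norm_le_of_spectralRadius_lt {A : Type*} [CStarAlgebra A] [PartialOrder A]
    [StarOrderedRing A] (S : StarSubalgebra ℂ A) (hS : IsClosed (S : Set A)) {y : A} (hy : y ∈ S)
    {ρ : NNReal} (hρ : spectralRadius ℂ y < ρ) :
    ∃ p ∈ S, ∃ q ∈ S, q * p = 1 ∧ ‖p * y * q‖ ≤ ρ := by
  have hρ0 : 0 < (ρ : ℝ) := by
    have := (zero_le (a := spectralRadius ℂ y)).trans_lt hρ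
    exact_mod_cast this
  obtain ⟨N, hN, hN1⟩ := (((spectrum.pow_nnnorm_pow_one_div_tendsto_nhds_spectralRadius
    y).eventually_lt_const hρ).and (Filter.eventually_ge_atTop 1)).exists
  have hyN : ‖y ^ N‖ ≤ ρ ^ N := by
    have h1 : ((‖y ^ N‖₊ : ENNReal)) < (ρ : ENNReal) ^ (N : ℝ) := by
      rw [one_div, ENNReal.rpow_inv_lt_iff (by exact_mod_cast hN1)] at hN
      exact hN
    rw [ENNReal.rpow_natCast] at h1
    exact_mod_cast h1.le
  have hc : ‖((((ρ : ℝ)⁻¹ : ℝ) : ℂ) • y) ^ N‖ ≤ 1 := by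
    rw [smul_pow, norm_smul, norm_pow, Complex.norm_real, Real.norm_of_nonneg (by positivity),
      inv_pow]
    exact inv_mul_le_one_of_le₀ hyN (by positivity)
  obtain ⟨p, hp, q, hq, hqp, h⟩ := exists_similar_contraction_of_norm_pow_le S hS
    (S.smul_mem hy (((ρ : ℝ)⁻¹ : ℝ) : ℂ)) (by omega) hc
  refine ⟨p, hp, q, hq, hqp, ?_⟩
  rw [mul_smul_comm, smul_mul_assoc, norm_smul, Complex.norm_real,
    Real.norm_of_nonneg (by positivity), inv_mul_le_iff₀ hρ0, mul_one] at h
  exact h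

/-- Let `δ` be a vector whose vector state is tracial on a closed star subalgebra `S` of operators.
If `y` lies in the corner of `S` cut out by a projection `e`, then the state at `y` is bounded by
the spectral radius of `y` times the state at `e`. -/
theorem norm_inner_apply_le_of_spectralRadius_lt {H : Type*} [NormedAddCommGroup H]
    [InnerProductSpace ℂ H] [CompleteSpace H] (S : StarSubalgebra ℂ (H →L[ℂ] H))
    (hS : IsClosed (S : Set (H →L[ℂ] H))) (δ : H)
    (htr : ∀ X ∈ S, ∀ Y ∈ S, inner ℂ δ ((X * Y) δ) = inner ℂ δ ((Y * X) δ))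
    {e y : H →L[ℂ] H} (hy : y ∈ S) (hesa : IsSelfAdjoint e)
    (hey : e * y = y) (hye : y * e = y) {ρ : NNReal} (hρ : spectralRadius ℂ y < ρ) :
    ‖inner ℂ δ (y δ)‖ ≤ ρ * ‖e δ‖ ^ 2 := by
  set C := StarSubalgebra.centralizer ℂ ({e} : Set (H →L[ℂ] H))
  have hC : IsClosed (C : Set (H →L[ℂ] H)) := by
    rw [StarSubalgebra.coe_centralizer]; exact Set.isClosed_centralizer _
  have hmemC : ∀ {z : H →L[ℂ] H}, z ∈ C ↔ e * z = z * e := by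
    intro z
    rw [StarSubalgebra.mem_centralizer_iff]
    simp [hesa.star_eq]
  -- Intersecting with the commutant of `e` makes the similarity preserve the corner, so that only
  -- `e δ` enters the estimate.
  obtain ⟨p, hp, q, hq, hqp, h⟩ := exists_similar_norm_le_of_spectralRadius_lt (S ⊓ C)
    (hS.inter hC) (y := y) ⟨hy, hmemC.2 (hey.trans hye.symm)⟩ hρ
  have hp' := hmemC.1 hp.2
  have hq' := hmemC.1 hq.2
  have h1 : inner ℂ δ (y δ) = inner ℂ δ ((p * y * q) δ) := by
    rw [mul_assoc, htr p hp.1 (y * q) (mul_mem hy hq.1), mul_assoc, hqp, mul_one]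
  have h2 : p * y * q = e * (p * y * q) * e := by
    calc p * y * q = p * (e * y * e) * q := by rw [hey, hye]
      _ = (p * e) * y * (e * q) := by simp only [mul_assoc]
      _ = e * (p * y * q) * e := by rw [← hp', hq']; simp only [mul_assoc]
  have h3 : inner ℂ δ ((p * y * q) δ) = inner ℂ (e δ) ((p * y * q) (e δ)) := by
    conv_lhs => rw [h2]
    rw [← ContinuousLinearMap.adjoint_inner_right, ← ContinuousLinearMap.star_eq_adjoint,
      hesa.star_eq]
    rfl
  rw [h1, h3]
  calc _ ≤ ‖e δ‖ * ‖(p * y * q) (e δ)‖ := norm_inner_le_norm _ _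
    _ ≤ ‖e δ‖ * (ρ * ‖e δ‖) := by
      gcongr
      exact (ContinuousLinearMap.le_opNorm _ _).trans (by gcongr)
    _ = ρ * ‖e δ‖ ^ 2 := by ring

/-! ### Free pairs of elements `1 + a`, `1 + b` with `a² = b² = 0` -/

open scoped Pointwise in
/-- The Ping-Pong Lemma for two cyclic groups. -/
theorem isFreePair_of_zpow_smul_subset {M α : Type*} [Group M] [MulAction M α] {u v : M}
    (X Y : Set α) (hX : X.Nonempty) (hY : Y.Nonempty) (hXY : Disjoint X Y)
    (hu : ∀ n : ℤ, n ≠ 0 → ∀ m ∈ Y, u ^ n • m ∈ X)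
    (hv : ∀ n : ℤ, n ≠ 0 → ∀ m ∈ X, v ^ n • m ∈ Y) : IsFreePair u v := by
  unfold IsFreePair
  set s : Fin 2 → M := ![u, v]
  have hs : FreeGroup.lift s =
      (Monoid.CoprodI.lift fun i => FreeGroup.lift fun _ => s i).comp
        (@freeGroupEquivCoprodI (Fin 2)).toMonoidHom := by
    ext i
    simp
  rw [hs, MonoidHom.coe_comp]
  refine Function.Injective.comp ?_ (MulEquiv.injective freeGroupEquivCoprodI)
  refine Monoid.CoprodI.lift_injective_of_ping_pong
    (fun i : Fin 2 => (FreeGroup.lift fun _ => s i : FreeGroup Unit →* M)) ?_ ![X, Y] ?_ ?_ ?_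
  -- With only two factors, ping-pong needs one of them to have at least three elements.
  · refine Or.inr ⟨0, ?_⟩
    rw [FreeGroup.freeGroupUnitEquivInt.cardinal_eq, Cardinal.mk_denumerable]
    exact Cardinal.natCast_le_aleph0 (n := 3)
  · intro i; fin_cases i <;> assumption
  · intro i j hij
    fin_cases i <;> fin_cases j <;> first | exact absurd rfl hij | exact hXY | exact hXY.symm
  · intro i j hij
    refine FreeGroup.freeGroupUnitEquivInt.forall_congr_left.mpr ?_
    intro n hne1
    have hn : n ≠ 0 := by
      rintro rfl
      apply hne1
      simp [FreeGroup.freeGroupUnitEquivInt]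
    change FreeGroup.lift (fun _ => s i) (FreeGroup.of () ^ n) • (![X, Y] : Fin 2 → Set α) j ⊆
      (![X, Y] : Fin 2 → Set α) i
    rw [map_zpow, FreeGroup.lift_apply_of]
    rintro _ ⟨m, hm, rfl⟩
    fin_cases i <;> fin_cases j
    · exact absurd rfl hij
    · exact hu n hn m hm
    · exact hv n hn m hm
    · exact absurd rfl hij

/-- A map intertwining the actions of two families of generators intertwines the actions of the
words in them. -/
theorem map_freeGroup_lift_smul {ι M M' α α' : Type*} [Group M] [Group M'] [MulAction M α]
    [MulAction M' α'] {s : ι → M} {s' : ι → M'} (f : α → α')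
    (hf : ∀ i m, f (s i • m) = s' i • f m) (w : FreeGroup ι) (m : α) :
    f (FreeGroup.lift s w • m) = FreeGroup.lift s' w • f m := by
  induction w using FreeGroup.induction_on generalizing m with
  | C1 => simp
  | of i => simpa using hf i m
  | inv_of i _ =>
    rw [map_inv, map_inv, FreeGroup.lift_apply_of, FreeGroup.lift_apply_of, eq_inv_smul_iff,
      ← hf, smul_inv_smul]
  | mul x y hx hy => rw [map_mul, map_mul, mul_smul, mul_smul, hx, hy]

theorem oneAddUnit_zpow_val {R : Type*} [Ring R] (a : R) (ha : a * a = 0) (n : ℤ) :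
    ((oneAddUnit a ha ^ n : Rˣ) : R) = 1 + n • a := by
  have hval : ((oneAddUnit a ha : Rˣ) : R) = 1 + a := rfl
  have hinv : (((oneAddUnit a ha)⁻¹ : Rˣ) : R) = 1 - a := rfl
  induction n using Int.induction_on with
  | zero => simp
  | succ n ih =>
    rw [zpow_add_one, Units.val_mul, ih, hval]
    simp only [mul_add, add_mul, smul_mul_assoc, ha, smul_zero, add_smul, one_smul, mul_one,
      one_mul]
    abel
  | pred n ih =>
    rw [zpow_sub_one, Units.val_mul, ih, hinv]
    simp only [mul_sub, add_mul, smul_mul_assoc, ha, smul_zero, sub_smul, one_smul, mul_one,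
      one_mul]
    abel

/-! ### Model unipotents and Sanov's theorem -/

/-- The endomorphism `(z, w) ↦ (0, z)` of `K × K`. -/
def lowerNilp (K : Type*) [CommRing K] : Module.End K (K × K) :=
  LinearMap.inr K K K ∘ₗ LinearMap.fst K K K

/-- The endomorphism `(z, w) ↦ (t w, 0)` of `K × K`. -/
def upperNilp {K : Type*} [CommRing K] (t : K) : Module.End K (K × K) :=
  t • (LinearMap.inl K K K ∘ₗ LinearMap.snd K K K)

theorem lowerNilp_apply {K : Type*} [CommRing K] (m : K × K) : lowerNilp K m = (0, m.1) := rfl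

theorem upperNilp_apply {K : Type*} [CommRing K] (t : K) (m : K × K) :
    upperNilp t m = (t * m.2, 0) := by
  simp [upperNilp]

theorem lowerNilp_mul_self (K : Type*) [CommRing K] : lowerNilp K * lowerNilp K = 0 := by
  ext <;> simp [lowerNilp_apply]

theorem upperNilp_mul_self {K : Type*} [CommRing K] (t : K) :
    upperNilp t * upperNilp t = 0 := by
  ext <;> simp [upperNilp_apply]

/-- The unipotent automorphism `(z, w) ↦ (z, w + z)`. -/
def lowerUnip (K : Type*) [CommRing K] : (Module.End K (K × K))ˣ :=
  oneAddUnit (lowerNilp K) (lowerNilp_mul_self K)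

/-- The unipotent automorphism `(z, w) ↦ (z + t w, w)`. -/
def upperUnip {K : Type*} [CommRing K] (t : K) : (Module.End K (K × K))ˣ :=
  oneAddUnit (upperNilp t) (upperNilp_mul_self t)

theorem lowerUnip_zpow_smul {K : Type*} [CommRing K] (n : ℤ) (m : K × K) :
    lowerUnip K ^ n • m = (m.1, m.2 + n * m.1) := by
  rw [Units.smul_def, lowerUnip, oneAddUnit_zpow_val]
  ext <;> simp [lowerNilp_apply]

theorem upperUnip_zpow_smul {K : Type*} [CommRing K] (t : K) (n : ℤ) (m : K × K) :
    upperUnip t ^ n • m = (m.1 + n * (t * m.2), m.2) := by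
  rw [Units.smul_def, upperUnip, oneAddUnit_zpow_val]
  ext <;> simp [upperNilp_apply]

theorem lowerUnip_smul {K : Type*} [CommRing K] (m : K × K) :
    lowerUnip K • m = (m.1, m.2 + m.1) := by
  simpa using lowerUnip_zpow_smul 1 m

theorem upperUnip_smul {K : Type*} [CommRing K] (t : K) (m : K × K) :
    upperUnip t • m = (m.1 + t * m.2, m.2) := by
  simpa using upperUnip_zpow_smul t 1 m

theorem one_le_norm_intCast {n : ℤ} (hn : n ≠ 0) : 1 ≤ ‖(n : ℂ)‖ := by
  rw [Complex.norm_intCast]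
  exact_mod_cast Int.one_le_abs hn

/-- Sanov's theorem, for a complex parameter. -/
theorem isFreePair_lowerUnip_upperUnip {t : ℂ} (ht : 4 ≤ ‖t‖) :
    IsFreePair (lowerUnip ℂ) (upperUnip t) := by
  refine isFreePair_of_zpow_smul_subset {m : ℂ × ℂ | ‖m.1‖ < 2 * ‖m.2‖}
    {m : ℂ × ℂ | 2 * ‖m.2‖ < ‖m.1‖} ⟨(0, 1), by simp⟩ ⟨(1, 0), by simp⟩ ?_ ?_ ?_
  · rw [Set.disjoint_left]
    exact fun m (h : ‖m.1‖ < 2 * ‖m.2‖) (h' : 2 * ‖m.2‖ < ‖m.1‖) => lt_asymm h h'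
  · intro n hn m hm
    rw [lowerUnip_zpow_smul]
    simp only [Set.mem_ofPred_eq] at hm ⊢
    have h1 : ‖(n : ℂ) * m.1‖ ≤ ‖m.2 + n * m.1‖ + ‖m.2‖ := by
      simpa using norm_sub_le (m.2 + n * m.1) m.2
    rw [norm_mul] at h1
    nlinarith [one_le_norm_intCast hn, norm_nonneg m.1]
  · intro n hn m hm
    rw [upperUnip_zpow_smul]
    simp only [Set.mem_ofPred_eq] at hm ⊢
    have h1 : ‖(n : ℂ) * (t * m.2)‖ ≤ ‖m.1 + n * (t * m.2)‖ + ‖m.1‖ := by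
      simpa using norm_sub_le (m.1 + n * (t * m.2)) m.1
    rw [norm_mul, norm_mul] at h1
    have h2 : 4 * ‖m.2‖ ≤ ‖t‖ * ‖m.2‖ := by gcongr
    nlinarith [one_le_norm_intCast hn, norm_nonneg m.2, norm_nonneg t]

open Polynomial in
/-- If a nontrivial word vanishes at `(1 + a, 1 + b)`, where `a² = b² = 0`, then every
complex number of modulus at least `4` is avoided by the roots of some polynomial
annihilating `a * b`. -/
theorem exists_aeval_mul_eq_zero_of_lift_eq_one {R : Type*} [Ring R] [Algebra ℂ R] {a b : R}
    (ha : a * a = 0) (hb : b * b = 0) {w : FreeGroup (Fin 2)} (hw : w ≠ 1)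
    (h : FreeGroup.lift ![oneAddUnit a ha, oneAddUnit b hb] w = 1) {t : ℂ} (ht : 4 ≤ ‖t‖) :
    ∃ Q : ℂ[X], aeval (a * b) Q = 0 ∧ Q.eval t ≠ 0 := by
  by_contra! hQ
  set N := ℂ[X] × ℂ[X]
  have ht0 : t ≠ 0 := by rintro rfl; norm_num at ht
  -- Left multiplication by `a` sends `b p(ab)` to `ab p(ab)`, and `b` sends `ab q(ab)` to `b
  -- (Xq)(ab)`; the other products vanish. So `θ` intertwines the model with parameter `X` and the
  -- two units.
  let θ : N → R := fun m => b * aeval (a * b) m.1 + a * b * aeval (a * b) m.2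
  have hval : ∀ (c : R) (hc : c * c = 0), ((oneAddUnit c hc : Rˣ) : R) = 1 + c := fun _ _ => rfl
  have hθ : ∀ i m, θ ((![lowerUnip ℂ[X], upperUnip X] : Fin 2 → _) i • m) =
      (![oneAddUnit a ha, oneAddUnit b hb] : Fin 2 → Rˣ) i • θ m := by
    intro i m
    fin_cases i
    · change θ (lowerUnip ℂ[X] • m) = oneAddUnit a ha • θ m
      rw [lowerUnip_smul, Units.smul_def, hval, smul_eq_mul]
      simp only [θ, map_add, mul_add, add_mul, one_mul, ← mul_assoc, ha, zero_mul]
      abel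
    · change θ (upperUnip X • m) = oneAddUnit b hb • θ m
      rw [upperUnip_smul, Units.smul_def, hval, smul_eq_mul]
      simp only [θ, map_add, map_mul, aeval_X, mul_add, add_mul, one_mul, ← mul_assoc, hb,
        zero_mul]
      abel
  have hev : ∀ i (m : N),
      Prod.map (eval t) (eval t) ((![lowerUnip ℂ[X], upperUnip X] : Fin 2 → _) i • m) =
      (![lowerUnip ℂ, upperUnip t] : Fin 2 → _) i • Prod.map (eval t) (eval t) m := by
    intro i m
    fin_cases i
    · change Prod.map (eval t) (eval t) (lowerUnip ℂ[X] • m) = lowerUnip ℂ • _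
      rw [lowerUnip_smul, lowerUnip_smul]
      simp
    · change Prod.map (eval t) (eval t) (upperUnip X • m) = upperUnip t • _
      rw [upperUnip_smul, upperUnip_smul]
      simp
  have key : ∀ m : N, FreeGroup.lift ![lowerUnip ℂ, upperUnip t] w •
      Prod.map (eval t) (eval t) m = Prod.map (eval t) (eval t) m := by
    intro m
    have h1 := map_freeGroup_lift_smul θ hθ w m
    rw [h, one_smul] at h1
    rw [← map_freeGroup_lift_smul _ hev w m]
    set m' := FreeGroup.lift ![lowerUnip ℂ[X], upperUnip X] w • m
    have h2 : b * aeval (a * b) (m'.1 - m.1) + a * b * aeval (a * b) (m'.2 - m.2) = 0 := by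
      rw [map_sub, map_sub]
      have h3 := sub_eq_zero.2 h1
      simp only [θ] at h3
      rw [← h3]
      simp only [mul_sub]
      abel
    -- Multiplying the relation by `a`, then by `a * b`, isolates each coordinate at the cost of
    -- factors `X`, harmless since `t ≠ 0`.
    have e1 : aeval (a * b) (X * (m'.1 - m.1)) = 0 := by
      have := congrArg (a * ·) h2
      simp only [mul_add, ← mul_assoc, ha, zero_mul, add_zero, mul_zero] at this
      rwa [map_mul, aeval_X]
    have e2 : aeval (a * b) (X * X * (m'.2 - m.2)) = 0 := by
      have := congrArg (a * b * ·) h2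
      have hbb : a * b * (b * aeval (a * b) (m'.1 - m.1)) = 0 := by
        rw [mul_assoc, ← mul_assoc b b, hb, zero_mul, mul_zero]
      simp only [mul_add, hbb, zero_add, mul_zero] at this
      rwa [map_mul, map_mul, aeval_X, mul_assoc]
    have f1 := hQ _ e1
    have f2 := hQ _ e2
    simp only [eval_mul, eval_X, eval_sub, mul_eq_zero, ht0, false_or, sub_eq_zero, or_self]
      at f1 f2
    exact Prod.ext f1 f2
  apply hw
  apply isFreePair_lowerUnip_upperUnip ht
  rw [map_one]
  ext1
  refine LinearMap.ext fun m => ?_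
  have := key (C m.1, C m.2)
  simpa [Units.smul_def] using this

/-! ### The regular representation on `ℓ²(G)` -/

/-- The action of permutations of `α` on `ℓ²(α)`. -/
noncomputable def permLp {α : Type*} (σ : Equiv.Perm α) :
    lp (fun _ : α => ℂ) 2 →L[ℂ] lp (fun _ : α => ℂ) 2 :=
  LinearIsometry.toContinuousLinearMap
    { toFun f := ⟨fun a => f (σ.symm a), memℓp_gen <|
        (σ.symm.summable_iff (f := fun a => ‖f a‖ ^ (2 : ENNReal).toReal)).2
          ((lp.memℓp f).summable (by norm_num))⟩
      map_add' _ _ := rfl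
      map_smul' _ _ := rfl
      norm_map' f := by
        rw [lp.norm_eq_tsum_rpow (by norm_num), lp.norm_eq_tsum_rpow (by norm_num)]
        congr 1
        exact σ.symm.tsum_eq (fun a => ‖f a‖ ^ (2 : ENNReal).toReal) }

theorem permLp_apply {α : Type*} (σ : Equiv.Perm α) (f : lp (fun _ : α => ℂ) 2) (a : α) :
    permLp σ f a = f (σ.symm a) := rfl

theorem permLp_mul {α : Type*} (σ τ : Equiv.Perm α) : permLp (σ * τ) = permLp σ * permLp τ :=
  rfl

open scoped Classical in
theorem permLp_single {α : Type*} (σ : Equiv.Perm α) (a : α) (z : ℂ) :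
    permLp σ (lp.single 2 a z) = lp.single 2 (σ a) z := by
  ext b
  rw [permLp_apply, lp.single_apply, lp.single_apply]
  simp only [Pi.single_apply, Equiv.symm_apply_eq]

theorem star_permLp {α : Type*} (σ : Equiv.Perm α) : star (permLp σ) = permLp σ⁻¹ := by
  rw [ContinuousLinearMap.star_eq_adjoint]
  symm
  rw [ContinuousLinearMap.eq_adjoint_iff]
  intro f g
  rw [lp.inner_eq_tsum, lp.inner_eq_tsum,
    ← σ.tsum_eq (fun a => inner ℂ (f a) (permLp σ g a))]
  simp only [permLp_apply, Equiv.symm_apply_apply]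
  rfl

/-- The operator on `ℓ²(G)` given by left multiplication by an element of `ℤG`. -/
noncomputable def leftRegular (G : Type*) [Group G] :
    MonoidAlgebra ℤ G →ₐ[ℤ] (lp (fun _ : G => ℂ) 2 →L[ℂ] lp (fun _ : G => ℂ) 2) :=
  MonoidAlgebra.lift ℤ _ G
    { toFun g := permLp (Equiv.mulLeft g)
      map_one' := by rw [Equiv.mulLeft_one]; rfl
      map_mul' g k := by rw [Equiv.mulLeft_mul]; rfl }

theorem leftRegular_grpElt {G : Type*} [Group G] (g : G) :
    leftRegular G (grpElt g) = permLp (Equiv.mulLeft g) := by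
  simp [leftRegular, grpElt]

/-- The von Neumann algebra of operators on `ℓ²(G)` commuting with right translations. -/
noncomputable def rightCommutant (G : Type*) [Group G] :
    StarSubalgebra ℂ (lp (fun _ : G => ℂ) 2 →L[ℂ] lp (fun _ : G => ℂ) 2) :=
  StarSubalgebra.centralizer ℂ (Set.range fun g : G => permLp (Equiv.mulRight g))

theorem isClosed_rightCommutant (G : Type*) [Group G] :
    IsClosed (rightCommutant G : Set (lp (fun _ : G => ℂ) 2 →L[ℂ] lp (fun _ : G => ℂ) 2)) := by
  rw [rightCommutant, StarSubalgebra.coe_centralizer]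
  exact Set.isClosed_centralizer _

theorem leftRegular_mem_rightCommutant {G : Type*} [Group G] (c : MonoidAlgebra ℤ G) :
    leftRegular G c ∈ rightCommutant G := by
  induction c using MonoidAlgebra.induction_on with
  | of g =>
    change leftRegular G (grpElt g) ∈ _
    rw [leftRegular_grpElt, rightCommutant, StarSubalgebra.mem_centralizer_iff]
    rintro _ ⟨k, rfl⟩
    simp only [star_permLp, ← permLp_mul]
    constructor <;> congr 1 <;> ext a <;> simp [mul_assoc]
  | add x y hx hy => rw [map_add]; exact add_mem hx hy
  | smul r x hx => rw [map_smul]; exact zsmul_mem hx r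

open scoped Classical in
/-- The unit vector of `ℓ²(G)` supported at the identity. -/
noncomputable def deltaOne (G : Type*) [Group G] : lp (fun _ : G => ℂ) 2 :=
  lp.single 2 1 1

theorem inner_deltaOne_left {G : Type*} [Group G] (f : lp (fun _ : G => ℂ) 2) :
    inner ℂ (deltaOne G) f = f 1 := by
  classical
  simpa [deltaOne] using lp.inner_single_left (𝕜 := ℂ) (1 : G) (1 : ℂ) f

/-- Commuting with right translations makes `S` determined by its value at `deltaOne G`. The
resulting series becomes symmetric in `S` and `T` under `g ↦ g⁻¹`, whence the trace property. -/
theorem hasSum_inner_deltaOne_mul {G : Type*} [Group G]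
    {S T : lp (fun _ : G => ℂ) 2 →L[ℂ] lp (fun _ : G => ℂ) 2} (hS : S ∈ rightCommutant G) :
    HasSum (fun g => S (deltaOne G) g⁻¹ * T (deltaOne G) g)
      (inner ℂ (deltaOne G) ((S * T) (deltaOne G))) := by
  classical
  have h1 : inner ℂ (deltaOne G) ((S * T) (deltaOne G)) =
      inner ℂ (ContinuousLinearMap.adjoint S (deltaOne G)) (T (deltaOne G)) := by
    rw [ContinuousLinearMap.adjoint_inner_left]; rfl
  rw [h1]
  suffices h : (fun g => S (deltaOne G) g⁻¹ * T (deltaOne G) g) =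
      fun g => inner ℂ (ContinuousLinearMap.adjoint S (deltaOne G) g) (T (deltaOne G) g) by
    rw [h]
    exact lp.hasSum_inner (𝕜 := ℂ) _ _
  funext g
  have h2 : S (lp.single 2 g 1) = permLp (Equiv.mulRight g) (S (deltaOne G)) := by
    have h3 : permLp (Equiv.mulRight g) * S = S * permLp (Equiv.mulRight g) :=
      ((StarSubalgebra.mem_centralizer_iff ℂ).1 hS _ ⟨g, rfl⟩).1
    have h4 := congrArg (fun W => W (deltaOne G)) h3
    change _ = S (permLp (Equiv.mulRight g) (deltaOne G)) at h4
    rw [deltaOne, permLp_single] at h4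
    simpa [deltaOne] using h4.symm
  have h3 : ContinuousLinearMap.adjoint S (deltaOne G) g = star (S (deltaOne G) g⁻¹) := by
    have h4 := lp.inner_single_left (𝕜 := ℂ) g (1 : ℂ)
      (ContinuousLinearMap.adjoint S (deltaOne G))
    rw [ContinuousLinearMap.adjoint_inner_right, h2, ← inner_conj_symm, inner_deltaOne_left,
      permLp_apply] at h4
    simpa using h4.symm
  rw [h3]
  simp [mul_comm]

/-- The vector state at the identity is tracial on the group von Neumann algebra. -/
theorem inner_deltaOne_mul_comm {G : Type*} [Group G]
    {S T : lp (fun _ : G => ℂ) 2 →L[ℂ] lp (fun _ : G => ℂ) 2} (hS : S ∈ rightCommutant G)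
    (hT : T ∈ rightCommutant G) :
    inner ℂ (deltaOne G) ((S * T) (deltaOne G)) =
      inner ℂ (deltaOne G) ((T * S) (deltaOne G)) := by
  refine (hasSum_inner_deltaOne_mul hS).unique ?_
  rw [← (Equiv.inv G).hasSum_iff]
  simpa [Function.comp_def, mul_comm] using hasSum_inner_deltaOne_mul (T := S) hT

theorem coeff_one_grpElt {G : Type*} [Group G] [DecidableEq G] (g : G) :
    (grpElt g).coeff 1 = if g = 1 then 1 else 0 := by
  simp [grpElt, Finsupp.single_apply]

theorem inner_deltaOne_leftRegular {G : Type*} [Group G] (c : MonoidAlgebra ℤ G) :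
    inner ℂ (deltaOne G) (leftRegular G c (deltaOne G)) = c.coeff 1 := by
  induction c using MonoidAlgebra.induction_on with
  | of g =>
    change inner ℂ (deltaOne G) (leftRegular G (grpElt g) (deltaOne G)) =
      ((grpElt g).coeff 1 : ℂ)
    classical
    rw [leftRegular_grpElt, inner_deltaOne_left, permLp_apply, coeff_one_grpElt, deltaOne,
      lp.single_apply, Pi.single_apply]
    simp
  | add x y hx hy =>
    rw [map_add, add_apply, inner_add_right, hx, hy]
    simp
  | smul r x hx =>
    rw [map_smul, smul_apply, ← Int.cast_smul_eq_zsmul ℂ, inner_smul_right, hx,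
      MonoidAlgebra.coeff_smul]
    simp

/-! ### Identities for the sum of the powers of `h` -/

theorem grpElt_mul {G : Type*} [Group G] (g k : G) : grpElt (g * k) = grpElt g * grpElt k :=
  map_mul (MonoidAlgebra.of ℤ G) g k

theorem grpElt_one {G : Type*} [Group G] : grpElt (1 : G) = 1 := map_one (MonoidAlgebra.of ℤ G)

theorem grpElt_pow {G : Type*} [Group G] (g : G) (n : ℕ) : grpElt (g ^ n) = grpElt g ^ n :=
  map_pow (MonoidAlgebra.of ℤ G) g n

theorem one_sub_mul_cycSum {G : Type*} [Group G] (h : G) : (1 - grpElt h) * cycSum h = 0 := by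
  unfold cycSum
  rw [mul_neg_geom_sum, grpElt_pow_orderOf, sub_self]

theorem grpElt_mul_cycSum {G : Type*} [Group G] (h : G) : grpElt h * cycSum h = cycSum h := by
  have := one_sub_mul_cycSum h
  rw [sub_mul, one_mul, sub_eq_zero] at this
  exact this.symm

theorem cycSum_mul_grpElt {G : Type*} [Group G] (h : G) : cycSum h * grpElt h = cycSum h := by
  have := cycSum_mul_one_sub h
  rw [mul_sub, mul_one, sub_eq_zero] at this
  exact this.symm

theorem grpElt_pow_mul_cycSum {G : Type*} [Group G] (h : G) (n : ℕ) :
    grpElt h ^ n * cycSum h = cycSum h := by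
  induction n with
  | zero => simp
  | succ n ih => rw [pow_succ, mul_assoc, grpElt_mul_cycSum, ih]

theorem cycSum_mul_grpElt_pow {G : Type*} [Group G] (h : G) (n : ℕ) :
    cycSum h * grpElt h ^ n = cycSum h := by
  induction n with
  | zero => simp
  | succ n ih => rw [pow_succ, ← mul_assoc, ih, cycSum_mul_grpElt]

theorem cycSum_mul_self {G : Type*} [Group G] (h : G) :
    cycSum h * cycSum h = orderOf h • cycSum h := by
  conv_lhs => enter [1]; unfold cycSum
  rw [Finset.sum_mul]
  simp [grpElt_pow_mul_cycSum]

theorem coeff_one_cycSum {G : Type*} [Group G] {h : G} (hh : IsOfFinOrder h) :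
    (cycSum h).coeff 1 = 1 := by
  classical
  rw [cycSum, MonoidAlgebra.coeff_sum, Finset.sum_apply',
    Finset.sum_eq_single_of_mem 0 (Finset.mem_range.2 hh.orderOf_pos)]
  · simp
  · intro i hi h0
    rw [← grpElt_pow, coeff_one_grpElt, if_neg]
    exact pow_ne_one_of_lt_orderOf h0 (Finset.mem_range.1 hi)

/-- The adjoint replaces `h ^ i` by `h ^ (d - i)`, which permutes the summands. The term `i = 0` is
split off before reflecting the range. -/
theorem isSelfAdjoint_leftRegular_cycSum {G : Type*} [Group G] (h : G) :
    IsSelfAdjoint (leftRegular G (cycSum h)) := by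
  rw [IsSelfAdjoint, cycSum, map_sum, star_sum]
  have hpow : ∀ i : ℕ, leftRegular G (grpElt h ^ i) = permLp (Equiv.mulLeft (h ^ i)) := fun i => by
    rw [← grpElt_pow, leftRegular_grpElt]
  have hstar : ∀ i ≤ orderOf h, star (leftRegular G (grpElt h ^ i)) =
      leftRegular G (grpElt h ^ (orderOf h - i)) := fun i hi => by
    rw [hpow, hpow, star_permLp, pow_sub _ hi, pow_orderOf_eq_one, one_mul]
    congr 1
    ext a
    rfl
  rw [Finset.sum_congr rfl fun i hi => hstar i (Finset.mem_range.1 hi).le]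
  rcases Nat.eq_zero_or_pos (orderOf h) with h0 | h0
  · simp [h0]
  obtain ⟨n, hn⟩ : ∃ n, orderOf h = n + 1 := ⟨_, (Nat.succ_pred_eq_of_pos h0).symm⟩
  have h1 : grpElt h ^ (n + 1) = 1 := hn ▸ grpElt_pow_orderOf h
  rw [hn, Finset.sum_range_succ', Finset.sum_range_succ', Nat.sub_zero, h1, pow_zero]
  congr 1
  rw [← Finset.sum_range_reflect]
  refine Finset.sum_congr rfl fun i hi => ?_
  have := Finset.mem_range.1 hi
  congr 2
  omega

/-! ### A criterion for free pairs in `ℤG` -/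

theorem coeff_one_mul_comm {G : Type*} [Group G] (a b : MonoidAlgebra ℤ G) :
    (a * b).coeff 1 = (b * a).coeff 1 := by
  have h := inner_deltaOne_mul_comm (leftRegular_mem_rightCommutant a)
    (leftRegular_mem_rightCommutant b)
  rw [← map_mul, ← map_mul, inner_deltaOne_leftRegular, inner_deltaOne_leftRegular] at h
  exact_mod_cast h

theorem norm_deltaOne (G : Type*) [Group G] : ‖deltaOne G‖ = 1 := by
  classical
  rw [deltaOne, lp.norm_single (by norm_num)]
  simp

instance nontrivial_lp_group (G : Type*) [Group G] : Nontrivial (lp (fun _ : G => ℂ) 2) :=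
  ⟨deltaOne G, 0, fun h => by simpa [h] using norm_deltaOne G⟩

/-- If `1 + a` and `1 + b` do not form a free pair, then every point of the spectrum of `a * b` on
`ℓ²(G)` has modulus less than `4`. -/
theorem norm_lt_four_of_not_isFreePair {G : Type*} [Group G] {a b : MonoidAlgebra ℤ G}
    (ha : a * a = 0) (hb : b * b = 0) (h : ¬ IsFreePair (oneAddUnit a ha) (oneAddUnit b hb))
    {t : ℂ} (ht : t ∈ spectrum ℂ (leftRegular G (a * b))) : ‖t‖ < 4 := by
  by_contra! ht4
  rw [IsFreePair, injective_iff_map_eq_one] at h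
  push Not at h
  obtain ⟨w, hw, hw1⟩ := h
  have ha' : leftRegular G a * leftRegular G a = 0 := by rw [← map_mul, ha, map_zero]
  have hb' : leftRegular G b * leftRegular G b = 0 := by rw [← map_mul, hb, map_zero]
  have hlift : FreeGroup.lift ![oneAddUnit _ ha', oneAddUnit _ hb'] =
      (Units.map (leftRegular G : MonoidAlgebra ℤ G →* _)).comp
        (FreeGroup.lift ![oneAddUnit a ha, oneAddUnit b hb]) := by
    ext i : 2
    fin_cases i <;> simp [oneAddUnit]
  obtain ⟨Q, hQ, hQt⟩ := exists_aeval_mul_eq_zero_of_lift_eq_one ha' hb' hw1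
    (by rw [hlift, MonoidHom.comp_apply, hw, map_one]) ht4
  have := spectrum.subset_polynomial_aeval (leftRegular G (a * b)) Q ⟨t, ht, rfl⟩
  rw [map_mul, hQ, spectrum.zero_eq, Set.mem_singleton_iff] at this
  exact hQt this

/-- If `a * b` lies in a one-sided ideal generated by the idempotent attached to `h`, and its
trace is at least the order of `h`, then `1 + a` and `1 + b` form a free pair. -/
theorem isFreePair_of_orderOf_le_coeff_one {G : Type*} [Group G] {h : G} (hh : IsOfFinOrder h)
    (h1 : h ≠ 1) {a b : MonoidAlgebra ℤ G} (ha : a * a = 0) (hb : b * b = 0)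
    (hc : cycSum h * (a * b) = orderOf h • (a * b) ∨ a * b * cycSum h = orderOf h • (a * b))
    (htr : (orderOf h : ℤ) ≤ (a * b).coeff 1) :
    IsFreePair (oneAddUnit a ha) (oneAddUnit b hb) := by
  by_contra hfree
  set d := orderOf h
  have hd0 : 0 < d := hh.orderOf_pos
  have hd2 : 2 ≤ d := by
    have : d ≠ 1 := fun h => h1 (orderOf_eq_one_iff.1 h)
    omega
  have hdC : (d : ℂ) ≠ 0 := by exact_mod_cast hd0.ne'
  set T := leftRegular G (a * b) with hT
  set e := (d : ℂ)⁻¹ • leftRegular G (cycSum h) with he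
  have hTm : T ∈ rightCommutant G := leftRegular_mem_rightCommutant _
  have hem : e ∈ rightCommutant G :=
    (rightCommutant G).smul_mem (leftRegular_mem_rightCommutant _) _
  have hscale : ∀ c : MonoidAlgebra ℤ G,
      (d : ℂ)⁻¹ • leftRegular G (d • c) = leftRegular G c := fun c => by
    rw [map_nsmul, ← Nat.cast_smul_eq_nsmul ℂ, smul_smul, inv_mul_cancel₀ hdC, one_smul]
  have hee : e * e = e := by
    have : e * e = (d : ℂ)⁻¹ • (d : ℂ)⁻¹ • leftRegular G (cycSum h * cycSum h) := by
      rw [he, map_mul, smul_mul_smul_comm, smul_smul]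
    rw [this, cycSum_mul_self, hscale]
  have hesa : IsSelfAdjoint e := by
    rw [he, IsSelfAdjoint, star_smul, (isSelfAdjoint_leftRegular_cycSum h).star_eq]
    simp
  have heT : e * T = T ∨ T * e = T := by
    refine hc.imp (fun h => ?_) (fun h => ?_)
    · rw [he, hT, smul_mul_assoc, ← map_mul, h, hscale]
    · rw [he, hT, mul_smul_comm, ← map_mul, h, hscale]
  -- The hypothesis gives absorption of `e` on one side only. Compressing to `e * T * e` puts the
  -- operator in the corner without changing the nonzero spectrum or the trace.
  have hsp : spectrum ℂ (e * (T * e)) \ {0} = spectrum ℂ T \ {0} := by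
    rw [spectrum.nonzero_mul_comm, mul_assoc, hee]
    rcases heT with h | h
    · rw [spectrum.nonzero_mul_comm, h]
    · rw [h]
  have hrad : spectralRadius ℂ (e * (T * e)) < (4 : NNReal) := by
    refine spectrum.spectralRadius_lt_of_forall_lt _ fun z hz => ?_
    by_cases hz0 : z = 0
    · simp [hz0]
    · have : z ∈ spectrum ℂ T := (hsp.subset ⟨hz, hz0⟩).1
      exact_mod_cast norm_lt_four_of_not_isFreePair ha hb hfree this
  -- Compactness of the spectrum made the bound 4 strict for the radius, leaving room for `ρ`; the
  -- strict inequality is what excludes `d = 2`.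
  obtain ⟨ρ, hρ, hρ4⟩ := ENNReal.lt_iff_exists_nnreal_btwn.1 hrad
  have hρ4' : (ρ : ℝ) < 4 := by exact_mod_cast hρ4
  have hbound := norm_inner_apply_le_of_spectralRadius_lt (rightCommutant G)
    (isClosed_rightCommutant G) (deltaOne G) (fun X hX Y hY => inner_deltaOne_mul_comm hX hY)
    (mul_mem hem (mul_mem hTm hem)) hesa (by rw [← mul_assoc, hee])
    (by rw [mul_assoc, mul_assoc, hee]) hρ
  have hτ : inner ℂ (deltaOne G) ((e * (T * e)) (deltaOne G)) = (a * b).coeff 1 := by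
    rw [inner_deltaOne_mul_comm hem (mul_mem hTm hem), mul_assoc, hee, ← inner_deltaOne_leftRegular]
    rcases heT with h | h
    · rw [inner_deltaOne_mul_comm hTm hem, h]
    · rw [h]
  have hτe : ‖e (deltaOne G)‖ ^ 2 = (d : ℝ)⁻¹ := by
    have h2 : inner ℂ (e (deltaOne G)) (e (deltaOne G)) = (d : ℂ)⁻¹ := by
      rw [← ContinuousLinearMap.adjoint_inner_right, ← ContinuousLinearMap.star_eq_adjoint,
        hesa.star_eq, ← mul_apply_eq_comp, hee, he, smul_apply, inner_smul_right,
        inner_deltaOne_leftRegular, coeff_one_cycSum hh]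
      simp
    rw [inner_self_eq_norm_sq_to_K] at h2
    apply Complex.ofReal_injective
    push_cast
    exact h2
  rw [hτ, hτe, Complex.norm_intCast] at hbound
  have h3 : (d : ℝ) ≤ |(((a * b).coeff 1 : ℤ) : ℝ)| :=
    le_trans (by exact_mod_cast htr) (le_abs_self _)
  have hd2' : (2 : ℝ) ≤ d := by exact_mod_cast hd2
  have h4 : (d : ℝ) * d ≤ ρ := by
    have := h3.trans hbound
    rwa [← div_eq_mul_inv, le_div_iff₀ (by positivity)] at this
  nlinarith

theorem IsFreePair.symm {M : Type*} [Group M] {u v : M} (h : IsFreePair u v) :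
    IsFreePair v u := by
  have : FreeGroup.lift ![v, u] = (FreeGroup.lift ![u, v]).comp
      (FreeGroup.freeGroupCongr (Equiv.swap (0 : Fin 2) 1)).toMonoidHom := by
    ext i
    fin_cases i <;> simp
  rw [IsFreePair, this, MonoidHom.coe_comp]
  exact Function.Injective.comp h (MulEquiv.injective _)

theorem IsFreePair.left_ne_one {M : Type*} [Group M] {u v : M} (h : IsFreePair u v) : u ≠ 1 := by
  intro hu
  have : FreeGroup.of (0 : Fin 2) = 1 := h (by simp [hu])
  exact FreeGroup.of_ne_one 0 this

/-! ### Traces of products of the elements defining the bicyclic units -/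

theorem coeff_one_cycSum_mul_mul {G : Type*} [Group G] [DecidableEq G] (h g k : G) :
    (cycSum h * grpElt g * cycSum h * grpElt k).coeff 1 =
      ∑ i ∈ Finset.range (orderOf h), ∑ j ∈ Finset.range (orderOf h),
        if h ^ i * g * h ^ j * k = 1 then 1 else 0 := by
  simp only [cycSum, Finset.sum_mul, Finset.mul_sum, ← grpElt_pow, ← grpElt_mul,
    MonoidAlgebra.coeff_sum, Finset.sum_apply', coeff_one_grpElt]
  rw [Finset.sum_comm]

theorem coeff_one_cycSum_mul_mul_nonneg {G : Type*} [Group G] (h g k : G) :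
    0 ≤ (cycSum h * grpElt g * cycSum h * grpElt k).coeff 1 := by
  classical
  rw [coeff_one_cycSum_mul_mul]
  exact Finset.sum_nonneg fun i _ => Finset.sum_nonneg fun j _ => by split_ifs <;> norm_num

theorem coeff_one_cycSum_mul_mul_eq_zero {G : Type*} [Group G] {h g k : G}
    (H : ∀ i j : ℕ, h ^ i * g * h ^ j * k ≠ 1) :
    (cycSum h * grpElt g * cycSum h * grpElt k).coeff 1 = 0 := by
  classical
  rw [coeff_one_cycSum_mul_mul]
  exact Finset.sum_eq_zero fun i _ => Finset.sum_eq_zero fun j _ => if_neg (H i j)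

theorem coeff_one_cycSum_mul_left_eq_zero {G : Type*} [Group G] {h g : G}
    (hg : g ∉ Subgroup.zpowers h) : (cycSum h * grpElt g * cycSum h).coeff 1 = 0 := by
  have := coeff_one_cycSum_mul_mul_eq_zero (h := h) (g := g) (k := 1) fun i j hij => hg <| by
    rw [mul_one, mul_assoc, mul_eq_one_iff_inv_eq, ← mul_inv_eq_iff_eq_mul] at hij
    rw [← hij]
    exact mul_mem (inv_mem (pow_mem (Subgroup.mem_zpowers h) i))
      (inv_mem (pow_mem (Subgroup.mem_zpowers h) j))
  rwa [grpElt_one, mul_one] at this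

theorem coeff_one_cycSum_mul_right_eq_zero {G : Type*} [Group G] {h k : G}
    (hk : k ∉ Subgroup.zpowers h) : (cycSum h * cycSum h * grpElt k).coeff 1 = 0 := by
  have := coeff_one_cycSum_mul_mul_eq_zero (h := h) (g := 1) (k := k) fun i j hij => hk <| by
    rw [mul_one, mul_eq_one_iff_inv_eq] at hij
    rw [← hij]
    exact inv_mem (mul_mem (pow_mem (Subgroup.mem_zpowers h) i)
      (pow_mem (Subgroup.mem_zpowers h) j))
  rwa [grpElt_one, mul_one] at this

theorem coeff_one_cycSum_mul_self {G : Type*} [Group G] {h : G} (hh : IsOfFinOrder h) :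
    (cycSum h * cycSum h).coeff 1 = orderOf h := by
  rw [cycSum_mul_self, MonoidAlgebra.coeff_smul]
  simp [coeff_one_cycSum hh]

/-- Of the four terms of the expansion, the first contributes the order of `h`, the two negative
ones vanish because `g` and `k` avoid `⟨h⟩`, and the last is a nonnegative count. -/
theorem orderOf_le_coeff_one_of_notMem {G : Type*} [Group G] {h g k : G} (hh : IsOfFinOrder h)
    (hg : g ∉ Subgroup.zpowers h) (hk : k ∉ Subgroup.zpowers h) :
    (orderOf h : ℤ) ≤ (cycSum h * (1 - grpElt g) * cycSum h * (1 - grpElt k)).coeff 1 := by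
  have : cycSum h * (1 - grpElt g) * cycSum h * (1 - grpElt k) =
      cycSum h * cycSum h - cycSum h * grpElt g * cycSum h - cycSum h * cycSum h * grpElt k +
        cycSum h * grpElt g * cycSum h * grpElt k := by noncomm_ring
  rw [this]
  simp only [MonoidAlgebra.coeff_add, MonoidAlgebra.coeff_sub, Finsupp.add_apply,
    Finsupp.sub_apply]
  rw [coeff_one_cycSum_mul_left_eq_zero hg, coeff_one_cycSum_mul_right_eq_zero hk,
    coeff_one_cycSum_mul_self hh]
  linarith [coeff_one_cycSum_mul_mul_nonneg h g k]

theorem orderOf_le_coeff_one_sq_of_notMem {G : Type*} [Group G] {h g : G} (hh : IsOfFinOrder h)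
    (hg : g ∉ Subgroup.zpowers h) :
    (orderOf h : ℤ) ≤ (cycSum h * (1 - grpElt g) * (1 - grpElt g) * cycSum h).coeff 1 := by
  have : cycSum h * (1 - grpElt g) * (1 - grpElt g) * cycSum h =
      cycSum h * cycSum h - cycSum h * grpElt g * cycSum h - cycSum h * grpElt g * cycSum h +
        cycSum h * grpElt (g * g) * cycSum h * grpElt 1 := by
    rw [grpElt_mul, grpElt_one]; noncomm_ring
  rw [this]
  simp only [MonoidAlgebra.coeff_add, MonoidAlgebra.coeff_sub, Finsupp.add_apply,
    Finsupp.sub_apply]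
  rw [coeff_one_cycSum_mul_left_eq_zero hg, coeff_one_cycSum_mul_self hh]
  linarith [coeff_one_cycSum_mul_mul_nonneg h (g * g) 1]

/-! ### Bicyclic units -/

theorem orderOf_conj {G : Type*} [Group G] (x h : G) : orderOf (x * h * x⁻¹) = orderOf h :=
  (MulAut.conj x).orderOf_eq h

theorem cycSum_conj {G : Type*} [Group G] (x h : G) :
    cycSum (x * h * x⁻¹) = grpElt x * cycSum h * grpElt x⁻¹ := by
  simp only [cycSum, orderOf_conj, Finset.mul_sum, Finset.sum_mul, ← grpElt_pow, ← grpElt_mul,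
    conj_pow]

/-- Finite order is essential: a conjugate of `⟨h⟩` contained in `⟨h⟩` equals it by cardinality. -/
theorem inv_mul_mul_mem_zpowers_iff {G : Type*} [Group G] {x h : G} (hh : IsOfFinOrder h) :
    x⁻¹ * h * x ∈ Subgroup.zpowers h ↔ x * h * x⁻¹ ∈ Subgroup.zpowers h := by
  suffices H : ∀ x : G, x * h * x⁻¹ ∈ Subgroup.zpowers h →
      x⁻¹ * h * x ∈ Subgroup.zpowers h from
    ⟨fun h' => by simpa using H x⁻¹ (by simpa using h'), H x⟩
  intro x hx
  have hle : Subgroup.zpowers (x * h * x⁻¹) ≤ Subgroup.zpowers h := by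
    rwa [Subgroup.zpowers_le]
  have hfin : Finite (Subgroup.zpowers h) := hh.finite_zpowers
  have heq := Subgroup.eq_of_le_of_card_ge hle (by
    rw [Nat.card_zpowers, Nat.card_zpowers, orderOf_conj])
  have hmem : h ∈ Subgroup.zpowers (x * h * x⁻¹) := heq ▸ Subgroup.mem_zpowers h
  obtain ⟨n, hn⟩ := Subgroup.mem_zpowers_iff.1 hmem
  rw [conj_zpow] at hn
  refine Subgroup.mem_zpowers_iff.2 ⟨n, ?_⟩
  conv_rhs => rw [← hn]
  group

theorem bicyclicBeta_eq_one {G : Type*} [Group G] {x h : G} (hh : IsOfFinOrder h)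
    (hx : x⁻¹ * h * x ∈ Subgroup.zpowers h) : bicyclicBeta x h = 1 := by
  obtain ⟨n, hn⟩ := hh.mem_powers_iff_mem_zpowers.2 hx
  have hn' : h * x = x * h ^ n := by
    simp only at hn; rw [hn]; group
  ext1
  change 1 + (1 - grpElt h) * grpElt x * cycSum h = 1
  rw [sub_mul, one_mul, ← grpElt_mul, hn', grpElt_mul, grpElt_pow, sub_mul, mul_assoc,
    grpElt_pow_mul_cycSum, sub_self, add_zero]

theorem bicyclicGamma_eq_one {G : Type*} [Group G] {x h : G} (hh : IsOfFinOrder h)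
    (hx : x * h * x⁻¹ ∈ Subgroup.zpowers h) : bicyclicGamma x h = 1 := by
  obtain ⟨n, hn⟩ := hh.mem_powers_iff_mem_zpowers.2 hx
  have hn' : x * h = h ^ n * x := by
    simp only at hn; rw [hn]; group
  ext1
  change 1 + cycSum h * grpElt x * (1 - grpElt h) = 1
  rw [mul_sub, mul_one, mul_assoc (cycSum h) (grpElt x), ← grpElt_mul, hn', grpElt_mul,
    grpElt_pow, ← mul_assoc, cycSum_mul_grpElt_pow, sub_self, add_zero]

theorem ne_one_of_conj_notMem_zpowers {G : Type*} [Group G] {x h : G}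
    (hx : x * h * x⁻¹ ∉ Subgroup.zpowers h) : h ≠ 1 := by
  rintro rfl
  simp at hx

/-- Inserting `x⁻¹ * x` between the two middle factors turns both into `1 - x h x⁻¹`, flanked by the
sums of powers of `h`. -/
theorem isFreePair_bicyclicGamma_bicyclicBeta {G : Type*} [Group G] {x h : G}
    (hh : IsOfFinOrder h) (hx : x * h * x⁻¹ ∉ Subgroup.zpowers h) :
    IsFreePair (bicyclicGamma x h) (bicyclicBeta x⁻¹ h) := by
  have hprod : cycSum h * grpElt x * (1 - grpElt h) * ((1 - grpElt h) * grpElt x⁻¹ * cycSum h) =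
      cycSum h * (1 - grpElt (x * h * x⁻¹)) * (1 - grpElt (x * h * x⁻¹)) * cycSum h := by
    have hconj : grpElt x * (1 - grpElt h) * grpElt x⁻¹ = 1 - grpElt (x * h * x⁻¹) := by
      rw [mul_sub, sub_mul, mul_one, ← grpElt_mul, ← grpElt_mul, ← grpElt_mul, mul_inv_cancel,
        grpElt_one]
    have hinv : grpElt x⁻¹ * grpElt x = (1 : MonoidAlgebra ℤ G) := by
      rw [← grpElt_mul, inv_mul_cancel, grpElt_one]
    rw [← hconj]
    calc _ = cycSum h * grpElt x * (1 - grpElt h) * 1 * (1 - grpElt h) * grpElt x⁻¹ *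
          cycSum h := by simp only [mul_one, mul_assoc]
      _ = _ := by rw [← hinv]; simp only [mul_assoc]
  refine isFreePair_of_orderOf_le_coeff_one hh (ne_one_of_conj_notMem_zpowers hx) _ _
    (Or.inl ?_) ?_
  · simp only [← mul_assoc, cycSum_mul_self, smul_mul_assoc]
  · rw [hprod]
    exact orderOf_le_coeff_one_sq_of_notMem hh hx

theorem isFreePair_bicyclicGamma_bicyclicGamma {G : Type*} [Group G] {x h : G}
    (hh : IsOfFinOrder h) (hx : x * h * x⁻¹ ∉ Subgroup.zpowers h)
    (hx' : x⁻¹ * h * x ∉ Subgroup.zpowers h) :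
    IsFreePair (bicyclicGamma x h) (bicyclicGamma x⁻¹ (x⁻¹ * h * x)) := by
  have hprod : cycSum h * grpElt x * (1 - grpElt h) *
      (cycSum (x⁻¹ * h * x) * grpElt x⁻¹ * (1 - grpElt (x⁻¹ * h * x))) =
      cycSum h * (1 - grpElt (x * h * x⁻¹)) * cycSum h * (1 - grpElt (x⁻¹ * h * x)) := by
    have hconj : grpElt x * (1 - grpElt h) * grpElt x⁻¹ = 1 - grpElt (x * h * x⁻¹) := by
      rw [mul_sub, sub_mul, mul_one, ← grpElt_mul, ← grpElt_mul, ← grpElt_mul, mul_inv_cancel,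
        grpElt_one]
    have hcyc := cycSum_conj x⁻¹ h
    rw [inv_inv] at hcyc
    have hinv : grpElt x * grpElt x⁻¹ = (1 : MonoidAlgebra ℤ G) := by
      rw [← grpElt_mul, mul_inv_cancel, grpElt_one]
    rw [← hconj, hcyc]
    calc _ = cycSum h * (grpElt x * (1 - grpElt h) * grpElt x⁻¹) * cycSum h *
          (grpElt x * grpElt x⁻¹) * (1 - grpElt (x⁻¹ * h * x)) := by simp only [mul_assoc]
      _ = _ := by rw [hinv, mul_one]
  refine isFreePair_of_orderOf_le_coeff_one hh (ne_one_of_conj_notMem_zpowers hx) _ _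
    (Or.inl ?_) ?_
  · simp only [← mul_assoc, cycSum_mul_self, smul_mul_assoc]
  · rw [hprod]
    exact orderOf_le_coeff_one_of_notMem hh hx hx'

/-- The pair is taken in this order so that the product ends in `cycSum h`; the trace bound then
applies after cyclic rotation. -/
theorem isFreePair_bicyclicBeta_bicyclicBeta {G : Type*} [Group G] {x h : G}
    (hh : IsOfFinOrder h) (hx : x * h * x⁻¹ ∉ Subgroup.zpowers h)
    (hx' : x⁻¹ * h * x ∉ Subgroup.zpowers h) :
    IsFreePair (bicyclicBeta x⁻¹ (x * h * x⁻¹)) (bicyclicBeta x h) := by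
  have hprod : (1 - grpElt (x * h * x⁻¹)) * grpElt x⁻¹ * cycSum (x * h * x⁻¹) *
      ((1 - grpElt h) * grpElt x * cycSum h) =
      (1 - grpElt (x * h * x⁻¹)) * (cycSum h * (1 - grpElt (x⁻¹ * h * x)) * cycSum h) := by
    have hconj : grpElt x⁻¹ * (1 - grpElt h) * grpElt x = 1 - grpElt (x⁻¹ * h * x) := by
      rw [mul_sub, sub_mul, mul_one, ← grpElt_mul, ← grpElt_mul, ← grpElt_mul, inv_mul_cancel,
        grpElt_one]
    have hinv : grpElt x⁻¹ * grpElt x = (1 : MonoidAlgebra ℤ G) := by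
      rw [← grpElt_mul, inv_mul_cancel, grpElt_one]
    rw [← hconj, cycSum_conj]
    calc _ = (1 - grpElt (x * h * x⁻¹)) * ((grpElt x⁻¹ * grpElt x) * cycSum h *
          (grpElt x⁻¹ * (1 - grpElt h) * grpElt x) * cycSum h) := by simp only [mul_assoc]
      _ = _ := by rw [hinv, one_mul]
  refine isFreePair_of_orderOf_le_coeff_one hh (ne_one_of_conj_notMem_zpowers hx) _ _
    (Or.inr ?_) ?_
  · simp only [mul_assoc, cycSum_mul_self, mul_smul_comm]
  · rw [hprod, coeff_one_mul_comm]
    exact orderOf_le_coeff_one_of_notMem hh hx' hx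

theorem mainTheorem4 {G : Type*} [Group G] (x h : G) (hh : IsOfFinOrder h) :
    List.TFAE [
      x⁻¹ * h * x ∉ Subgroup.zpowers h,
      x * h * x⁻¹ ∉ Subgroup.zpowers h,
      bicyclicBeta x h ≠ 1,
      bicyclicGamma x h ≠ 1,
      IsFreePair (bicyclicBeta x h) (bicyclicBeta x⁻¹ (x * h * x⁻¹)),
      IsFreePair (bicyclicBeta x h) (bicyclicGamma x⁻¹ h),
      IsFreePair (bicyclicGamma x h) (bicyclicBeta x⁻¹ h),
      IsFreePair (bicyclicGamma x h) (bicyclicGamma x⁻¹ (x⁻¹ * h * x))] := by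
  have hiff := not_congr (inv_mul_mul_mem_zpowers_iff (x := x) hh)
  tfae_have 1 ↔ 2 := hiff
  tfae_have 3 → 1 := fun H hx => H (bicyclicBeta_eq_one hh hx)
  tfae_have 4 → 2 := fun H hx => H (bicyclicGamma_eq_one hh hx)
  tfae_have 5 → 3 := IsFreePair.left_ne_one
  tfae_have 6 → 3 := IsFreePair.left_ne_one
  tfae_have 7 → 4 := IsFreePair.left_ne_one
  tfae_have 8 → 4 := IsFreePair.left_ne_one
  tfae_have 1 → 5 := fun H =>
    (isFreePair_bicyclicBeta_bicyclicBeta hh (hiff.1 H) H).symm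
  tfae_have 1 → 6 := fun H => by
    -- Condition 6 is condition 7 for `x⁻¹`, with the two entries swapped.
    have := isFreePair_bicyclicGamma_bicyclicBeta (x := x⁻¹) hh (by rwa [inv_inv])
    rw [inv_inv] at this
    exact this.symm
  tfae_have 2 → 7 := isFreePair_bicyclicGamma_bicyclicBeta hh
  tfae_have 1 → 8 := fun H => isFreePair_bicyclicGamma_bicyclicGamma hh (hiff.1 H) H
  tfae_finish
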